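/- Let $G$ be a (Gromov) hyperbolic group, that is, a group which has a finite symmetric generating set $\mathcal A$ and a constant $\delta \ge 0$ such that, in the Cayley graph of $G$ with respect to $\mathcal A$, each side of every geodesic triangle lies in the closed $\delta$-neighbourhood of the union of the two other sides. The profinite topology on a group $L$ is the topology whose basic open sets are the cosets of the finite index normal subgroups of $L$; a subset of $L$ is separable in $L$ if it is closed in this topology, and $L$ is conjugacy separable if the conjugacy class of every element of $L$ is separable in $L$. Suppose that $G$ is hereditarily conjugacy separable, i.e. every finite index subgroup of $G$ is conjugacy separable. If $H \le G$ is a torsion-free subgroup (every non-trivial element has infinite order) and $H$ is separable in $G$, then $H$ is conjugacy separable. -/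

import Mathlib

open scoped Pointwise

/-- The graph `Γ` (with each edge of length `1`) has `δ`-slim geodesic triangles: for any
geodesic edge paths `p`, `q`, `r` forming a triangle with vertices `x`, `y`, `z`, the side `p` lies
in the closed `δ`-neighbourhood of the union of the two other sides. Every side of a triangle can
play the role of `p`, since the triangle may be relabelled. A geodesic edge path is a walk whose
length is the distance between its endpoints. The condition is only imposed on triangles whose
corners are vertices of `Γ`, and on the vertices along the sides; for a connected graph, this holds
for some `δ` if and only if the geometric realization of `Γ` is a Gromov hyperbolic geodesic
metric space (the constants differ by a bounded amount). -/
def SimpleGraph.HasSlimTriangles {V : Type*} (Γ : SimpleGraph V) (δ : ℕ) : Prop :=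
  ∀ (x y z : V) (p : Γ.Walk x y) (q : Γ.Walk y z) (r : Γ.Walk z x),
    p.length = Γ.dist x y → q.length = Γ.dist y z → r.length = Γ.dist z x →
      ∀ v ∈ p.support, ∃ w, (w ∈ q.support ∨ w ∈ r.support) ∧ Γ.dist v w ≤ δ

/-- A group is hyperbolic if it has a finite symmetric generating set `A` such that the geodesic
triangles in the Cayley graph with respect to `A` (edges join `g` and `g * a`, `a ∈ A`) are
uniformly slim. -/
def IsHyperbolicGroup (G : Type*) [Group G] : Prop :=
  ∃ A : Set G, A.Finite ∧ A⁻¹ = A ∧ Subgroup.closure A = ⊤ ∧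
    ∃ δ : ℕ, (SimpleGraph.mulCayley A).HasSlimTriangles δ

/-- The profinite topology on a group, whose basic open sets are the cosets of the normal subgroups
of finite index. It is not an instance. -/
@[reducible] def profiniteTopology (G : Type*) [Group G] : TopologicalSpace G :=
  TopologicalSpace.generateFrom
    {U | ∃ N : Subgroup G, N.Normal ∧ N.FiniteIndex ∧ ∃ g : G, U = g • (N : Set G)}

/-- A subset of a group is separable if it is closed in the profinite topology. -/
def IsSeparableIn {G : Type*} [Group G] (A : Set G) : Prop :=
  @IsClosed G (profiniteTopology G) A

/-- A group is conjugacy separable if every conjugacy class is closed in its profinite topology. -/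
def IsConjugacySeparable (G : Type*) [Group G] : Prop :=
  ∀ g : G, IsSeparableIn (conjugatesOf g)

/-- A group is hereditarily conjugacy separable if every subgroup of finite index is conjugacy
separable. -/
def IsHereditarilyConjugacySeparable (G : Type*) [Group G] : Prop :=
  ∀ K : Subgroup G, K.FiniteIndex → IsConjugacySeparable K

/-- A group is torsion-free if its only element of finite order is `1`. (For non-commutative groups
this is weaker than `IsMulTorsionFree`, which requires `n`-th roots to be unique.) -/
def IsTorsionFreeGroup (G : Type*) [Group G] : Prop :=
  ∀ g : G, IsOfFinOrder g → g = 1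

/-! ### Separability and conjugacy in the profinite topology. -/

section ProfiniteTopology

variable {G : Type*} [Group G]

/-! Let `x = g h g⁻¹` with `h`, `x` in `H`. The elements conjugating `h` to `x` form `g C(h)`, where
`C(h)` is the centralizer of `h` in `G`, so `h` and `x` are conjugate in `H` iff `H` meets `g C(h)`.
If it does not, a finite quotient must witness this.

Two facts do so. Hereditary conjugacy separability gives the centralizer condition
(`exists_normal_centralizer`): in a suitable finite quotient, the centralizer of the image of `h` is
no larger than the image of `C(h) K`, with `K` any chosen normal subgroup of finite index.
Hyperbolicity makes `⟨h⟩` of finite index in `C(h)` for `h` of infinite order, so `C(h)` lies in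
finitely many cosets `H f`. It then suffices to separate finitely many `g f⁻¹` from the closed set
`H`.

The finite index comes from slim quadrilaterals: a long element of minimal length in `⟨h ^ N⟩ c`
would have a point `m` on its geodesic that `h` moves a bounded distance and `h ^ N` moves at most
`4δ`, which the choice of `N` forbids. -/

theorem mem_conjugatesOf_iff_exists {g x : G} :
    x ∈ conjugatesOf g ↔ ∃ c, c * g * c⁻¹ = x :=
  isConj_iff

theorem isOpen_profiniteTopology_iff {U : Set G} :
    @IsOpen G (profiniteTopology G) U ↔
      ∀ x ∈ U, ∃ N : Subgroup G, N.Normal ∧ N.FiniteIndex ∧ ∀ y, x⁻¹ * y ∈ N → y ∈ U := by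
  constructor
  · intro hU
    induction hU with
    | basic s hs =>
      obtain ⟨N, hN, hf, g, rfl⟩ := hs
      intro x hx
      refine ⟨N, hN, hf, fun y hy => ?_⟩
      rw [mem_leftCoset_iff] at hx ⊢
      have := N.mul_mem hx hy
      rwa [mul_assoc, mul_inv_cancel_left] at this
    | univ => exact fun x _ => ⟨⊤, inferInstance, inferInstance, fun y _ => Set.mem_univ y⟩
    | inter s t _ _ ihs iht =>
      intro x hx
      obtain ⟨M, hM, hMf, h1⟩ := ihs x hx.1
      obtain ⟨N, hN, hNf, h2⟩ := iht x hx.2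
      exact ⟨M ⊓ N, inferInstance, inferInstance,
        fun y hy => ⟨h1 y hy.1, h2 y hy.2⟩⟩
    | sUnion S _ ih =>
      rintro x ⟨s, hs, hx⟩
      obtain ⟨N, hN, hf, h⟩ := ih s hs x hx
      exact ⟨N, hN, hf, fun y hy => ⟨s, hs, h y hy⟩⟩
  · intro h
    rw [@isOpen_iff_forall_mem_open G (profiniteTopology G) U]
    intro x hx
    obtain ⟨N, hN, hf, hU⟩ := h x hx
    refine ⟨x • (N : Set G), fun y hy => hU y ((mem_leftCoset_iff x).1 hy),
      .basic _ ⟨N, hN, hf, x, rfl⟩, ?_⟩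
    rw [mem_leftCoset_iff]
    simp

theorem isSeparableIn_iff {A : Set G} :
    IsSeparableIn A ↔
      ∀ x ∉ A, ∃ N : Subgroup G, N.Normal ∧ N.FiniteIndex ∧ ∀ a ∈ A, x⁻¹ * a ∉ N := by
  unfold IsSeparableIn
  rw [← @isOpen_compl_iff G A (profiniteTopology G), isOpen_profiniteTopology_iff]
  refine forall₂_congr fun x _ => exists_congr fun N => and_congr_right fun _ =>
    and_congr_right fun _ => forall_congr' fun y => ?_
  simp only [Set.mem_compl_iff]
  tauto

/-- In a hereditarily conjugacy separable group, the orbit of an element under conjugation by a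
normal subgroup of finite index is separable. -/
theorem IsHereditarilyConjugacySeparable.exists_normal_forall_conj_notMem
    (hG : IsHereditarilyConjugacySeparable G) (K : Subgroup G) [K.Normal] [K.FiniteIndex]
    (h x : G) (hx : ∀ k ∈ K, k * h * k⁻¹ ≠ x) :
    ∃ L : Subgroup G, L.Normal ∧ L.FiniteIndex ∧ ∀ k ∈ K, x⁻¹ * (k * h * k⁻¹) ∉ L := by
  -- Powers of `h` fix `h` under conjugation, so the `K`-orbit of `h` is its full conjugacy class in
  -- `M`.
  let M : Subgroup G := K ⊔ Subgroup.zpowers h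
  have hKM : K ≤ M := le_sup_left
  have hhM : h ∈ M := Subgroup.mem_sup_right (Subgroup.mem_zpowers h)
  have hMf : M.FiniteIndex := Subgroup.finiteIndex_of_le hKM
  by_cases hxM : x ∈ M
  · have hsep := isSeparableIn_iff.1 (hG M hMf ⟨h, hhM⟩) ⟨x, hxM⟩ (by
      rw [mem_conjugatesOf_iff_exists]
      rintro ⟨⟨c, hc⟩, hcx⟩
      obtain ⟨k, hk, z, hz, rfl⟩ := Subgroup.mem_sup_of_normal_left.1 hc
      obtain ⟨n, rfl⟩ := Subgroup.mem_zpowers_iff.1 hz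
      refine hx k hk ?_
      have := congrArg Subtype.val hcx
      simp only [Subgroup.coe_mul, Subgroup.coe_inv] at this
      have hcomm : h ^ n * h = h * h ^ n := (Commute.refl h).zpow_left n
      rw [← this, mul_inv_rev, mul_assoc k (h ^ n) h, hcomm]
      group)
    obtain ⟨N, hN, hNf, hNx⟩ := hsep
    have : (N.map M.subtype).FiniteIndex := by
      refine ⟨?_⟩
      rw [Subgroup.index_map_subtype]
      exact mul_ne_zero hNf.index_ne_zero hMf.index_ne_zero
    refine ⟨(N.map M.subtype).normalCore, inferInstance, inferInstance, fun k hk hmem => ?_⟩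
    have hmem' := (N.map M.subtype).normalCore_le hmem
    obtain ⟨y, hy, hyx⟩ := hmem'
    refine hNx (⟨k, hKM hk⟩ * ⟨h, hhM⟩ * ⟨k, hKM hk⟩⁻¹) ?_ ?_
    · rw [mem_conjugatesOf_iff_exists]
      exact ⟨_, rfl⟩
    · rwa [show (⟨x, hxM⟩ : M)⁻¹ * (⟨k, hKM hk⟩ * ⟨h, hhM⟩ * ⟨k, hKM hk⟩⁻¹) = y from
        Subtype.ext hyx.symm]
  · refine ⟨K, inferInstance, inferInstance, fun k hk hmem => hxM ?_⟩
    have h1 : k * h * k⁻¹ ∈ M := M.mul_mem (M.mul_mem (hKM hk) hhM) (M.inv_mem (hKM hk))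
    have h2 := M.mul_mem h1 (M.inv_mem (hKM hmem))
    simpa [mul_assoc] using h2

/-- The centralizer condition: modulo a suitable normal subgroup of finite index, only the image of
`K` times the centralizer of `h` commutes with `h`. -/
theorem IsHereditarilyConjugacySeparable.exists_normal_centralizer
    (hG : IsHereditarilyConjugacySeparable G) (K : Subgroup G) [K.Normal] [K.FiniteIndex] (h : G) :
    ∃ L : Subgroup G, L.Normal ∧ L.FiniteIndex ∧
      ∀ z, (z⁻¹ * h * z)⁻¹ * h ∈ L → ∃ k ∈ K, Commute (z * k) h := by
  -- One `L` per coset of `K`: if the coset misses the centralizer of `h`, its representative does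
  -- not conjugate `h` into the `K`-orbit of `h`, and `L` keeps the two apart.
  have key : ∀ q : G ⧸ K, ∃ L : Subgroup G, L.Normal ∧ L.FiniteIndex ∧
      ((∃ k ∈ K, Commute (q.out * k) h) ∨
        ∀ k ∈ K, (q.out⁻¹ * h * q.out)⁻¹ * (k * h * k⁻¹) ∉ L) := by
    intro q
    by_cases hq : ∃ k ∈ K, Commute (q.out * k) h
    · exact ⟨⊤, inferInstance, inferInstance, .inl hq⟩
    · obtain ⟨L, hL, hLf, hLq⟩ := hG.exists_normal_forall_conj_notMem K h
        (q.out⁻¹ * h * q.out) (by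
          intro k hk hkq
          refine hq ⟨k, hk, ?_⟩
          have : q.out * (k * h * k⁻¹) * k = q.out * (q.out⁻¹ * h * q.out) * k := by rw [hkq]
          simpa [mul_assoc, Commute, SemiconjBy] using this)
      exact ⟨L, hL, hLf, .inr hLq⟩
  choose L hL hLf hLq using key
  refine ⟨⨅ q, L q, Subgroup.normal_iInf_normal hL, Subgroup.finiteIndex_iInf hLf,
    fun z hz => ?_⟩
  have hk : (z : G ⧸ K).out⁻¹ * z ∈ K := by
    rw [← QuotientGroup.eq, QuotientGroup.out_eq']
  have hzL := Subgroup.mem_iInf.1 hz (z : G ⧸ K)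
  rcases hLq (z : G ⧸ K) with ⟨k, hk', hc⟩ | hno
  · refine ⟨z⁻¹ * (z : G ⧸ K).out * k, K.mul_mem (by simpa using K.inv_mem hk) hk', ?_⟩
    simpa [mul_assoc] using hc
  · refine absurd ?_ (hno _ hk)
    have := (hL (z : G ⧸ K)).conj_mem _ hzL ((z : G ⧸ K).out⁻¹ * z)
    simpa [mul_assoc] using this

end ProfiniteTopology

/-- In a hereditarily conjugacy separable group, conjugacy classes in a subgroup `H` are separable as soon as
`H` is separable and the centralizers of elements of `H` are covered by finitely many
cosets of `H`. -/
theorem IsHereditarilyConjugacySeparable.isConjugacySeparable_of_finite {G : Type*} [Group G]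
    (hG : IsHereditarilyConjugacySeparable G) (H : Subgroup G) (hH : IsSeparableIn (H : Set G))
    (hfin : ∀ h ∈ H, h ≠ 1 → ∃ F : Set G, F.Finite ∧
      ∀ c, Commute c h → ∃ u ∈ H, ∃ f ∈ F, c = u * f) :
    IsConjugacySeparable H := by
  intro h
  rw [isSeparableIn_iff]
  intro x hx
  suffices ∃ L : Subgroup G, L.Normal ∧ L.FiniteIndex ∧
      ∀ u ∈ H, (x : G)⁻¹ * (u * h * u⁻¹) ∉ L by
    obtain ⟨L, hL, hLf, hLx⟩ := this
    refine ⟨L.subgroupOf H, inferInstance, inferInstance, fun a ha hmem => ?_⟩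
    obtain ⟨u, rfl⟩ := mem_conjugatesOf_iff_exists.1 ha
    exact hLx u u.2 (by simpa [Subgroup.mem_subgroupOf] using hmem)
  by_cases hxh : ∃ g : G, g * h * g⁻¹ = x
  · obtain ⟨g, hg⟩ := hxh
    have hne : (h : G) ≠ 1 := by
      intro h1
      refine hx ?_
      rw [mem_conjugatesOf_iff_exists]
      exact ⟨1, Subtype.ext (by simp [← hg, h1])⟩
    obtain ⟨F, hF, hcov⟩ := hfin h h.2 hne
    -- the finitely many relevant cosets avoid `H`
    have key : ∀ f : F, ∃ N : Subgroup G, N.Normal ∧ N.FiniteIndex ∧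
        ((∃ u ∈ H, Commute (u * f) h) → ∀ a ∈ H, (g * (f : G)⁻¹)⁻¹ * a ∉ N) := by
      intro f
      by_cases hf : ∃ u ∈ H, Commute (u * f) h
      · obtain ⟨u, hu, hc⟩ := hf
        obtain ⟨N, hN, hNf, hNx⟩ := isSeparableIn_iff.1 hH (g * (f : G)⁻¹) (by
          intro hmem
          refine hx ?_
          rw [mem_conjugatesOf_iff_exists]
          -- Since `u f` centralizes `h`, the element `g f⁻¹ u⁻¹ = g (u f)⁻¹` also conjugates `h` to
          -- `x`.
          refine ⟨⟨g * (f : G)⁻¹, hmem⟩ * ⟨u, hu⟩⁻¹, Subtype.ext ?_⟩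
          have hc' : (u * f)⁻¹ * (h : G) * (u * f) = h := by
            rw [mul_assoc, ← hc.eq, inv_mul_cancel_left]
          simp only [Subgroup.coe_mul, Subgroup.coe_inv]
          rw [← hg]
          conv_rhs => rw [← hc']
          group)
        exact ⟨N, hN, hNf, fun _ => hNx⟩
      · exact ⟨⊤, inferInstance, inferInstance, fun h' => absurd h' hf⟩
    choose N hN hNf hNx using key
    have : Finite F := hF
    have hKn : (⨅ f, N f).Normal := Subgroup.normal_iInf_normal hN
    have hKf : (⨅ f, N f).FiniteIndex := Subgroup.finiteIndex_iInf hNf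
    obtain ⟨L, hL, hLf, hLz⟩ := hG.exists_normal_centralizer (⨅ f, N f) h
    refine ⟨L, hL, hLf, fun a ha hmem => ?_⟩
    -- Modulo `L`, `a⁻¹ g` commutes with `h`. Hence `a⁻¹ g k = u f` for some `k`, and `a u = g f⁻¹
    -- (f k f⁻¹)` lies both in `H` and in a coset chosen to avoid `H`.
    obtain ⟨k, hk, hc⟩ := hLz (a⁻¹ * g) (by
      have := L.inv_mem (hL.conj_mem _ hmem g⁻¹)
      rw [← hg] at this
      simpa [mul_assoc] using this)
    obtain ⟨u, hu, f, hf, huf⟩ := hcov _ hc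
    refine hNx ⟨f, hf⟩ ⟨u, hu, huf ▸ hc⟩ (a * u) (H.mul_mem ha hu) ?_
    have hk' := (hN ⟨f, hf⟩).conj_mem _ (Subgroup.mem_iInf.1 hk ⟨f, hf⟩) f
    have hau : a * u = g * k * f⁻¹ := by
      rw [eq_mul_inv_iff_mul_eq, mul_assoc, ← huf]
      group
    rw [hau]
    simpa [mul_assoc] using hk'
  · push Not at hxh
    obtain ⟨L, hL, hLf, hLx⟩ := hG.exists_normal_forall_conj_notMem ⊤ h x fun k _ => hxh k
    exact ⟨L, hL, hLf, fun u _ => hLx u trivial⟩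

namespace SimpleGraph

/-! ### Geodesics and slim quadrilaterals. -/

section Geodesics

variable {V : Type*} {Γ : SimpleGraph V}

theorem Walk.dist_add_dist_of_mem_support {x y v : V} {p : Γ.Walk x y}
    (hp : p.length = Γ.dist x y) (hv : v ∈ p.support) :
    Γ.dist x v + Γ.dist v y = Γ.dist x y := by
  classical
  rw [← length_eq_dist_of_subwalk hp (p.isSubwalk_takeUntil hv),
    ← length_eq_dist_of_subwalk hp (p.isSubwalk_dropUntil hv), ← hp, ← Walk.length_append,
    p.take_spec hv]

theorem Walk.dist_add_dist_add_dist_of_mem_support {x y v w : V} {p : Γ.Walk x y}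
    (hp : p.length = Γ.dist x y) (hv : v ∈ p.support) (hw : w ∈ p.support) :
    Γ.dist x v + Γ.dist v w + Γ.dist w y = Γ.dist x y ∨
      Γ.dist x w + Γ.dist w v + Γ.dist v y = Γ.dist x y := by
  classical
  have h := dist_add_dist_of_mem_support hp hv
  rw [← p.take_spec hv, Walk.mem_support_append_iff] at hw
  rcases hw with hw | hw
  · have := dist_add_dist_of_mem_support
      (length_eq_dist_of_subwalk hp (p.isSubwalk_takeUntil hv)) hw
    omega
  · have := dist_add_dist_of_mem_support
      (length_eq_dist_of_subwalk hp (p.isSubwalk_dropUntil hv)) hw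
    omega

theorem Walk.exists_mem_support_dist_eq {x y : V} {p : Γ.Walk x y}
    (hp : p.length = Γ.dist x y) {n : ℕ} (hn : n ≤ Γ.dist x y) :
    ∃ v ∈ p.support, Γ.dist x v = n := by
  refine ⟨p.getVert n, p.getVert_mem_support n, ?_⟩
  rw [← length_eq_dist_of_subwalk hp (p.isSubwalk_take n), p.take_length]
  omega

theorem HasSlimTriangles.exists_dist_le_of_quadrilateral {δ : ℕ} (hδ : Γ.HasSlimTriangles δ)
    (hΓ : Γ.Connected) {x y z w v : V} {p : Γ.Walk x y} {q : Γ.Walk y z} {r : Γ.Walk z w}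
    {s : Γ.Walk w x} (hp : p.length = Γ.dist x y) (hq : q.length = Γ.dist y z)
    (hr : r.length = Γ.dist z w) (hs : s.length = Γ.dist w x) (hv : v ∈ p.support) :
    ∃ t, (t ∈ q.support ∨ t ∈ r.support ∨ t ∈ s.support) ∧ Γ.dist v t ≤ 2 * δ := by
  obtain ⟨d, hd⟩ := hΓ.exists_walk_length_eq_dist z x
  obtain ⟨t, ht | ht, hvt⟩ := hδ x y z p q d hp hq hd v hv
  · exact ⟨t, .inl ht, by omega⟩
  · obtain ⟨t', ht', htt'⟩ := hδ z x w d s.reverse r.reverse hd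
      (by rw [Walk.length_reverse, hs, dist_comm]) (by rw [Walk.length_reverse, hr, dist_comm]) t ht
    rw [Walk.support_reverse, Walk.support_reverse, List.mem_reverse, List.mem_reverse] at ht'
    have := hΓ.dist_triangle (u := v) (v := t) (w := t')
    exact ⟨t', .inr ht'.symm, by omega⟩

end Geodesics

/-! ### Displacement along geodesics in Cayley graphs. -/

section Cayley

variable {G : Type*} [Group G]

/-- Left translation as an endomorphism of the Cayley graph. -/
def mulCayleyMulLeft (A : Set G) (a : G) : mulCayley A →g mulCayley A :=
  ⟨fun x => a * x, fun h => mulCayley_adj_mul_iff_right.2 h⟩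

@[simp]
theorem mulCayleyMulLeft_apply (A : Set G) (a x : G) : mulCayleyMulLeft A a x = a * x :=
  rfl

variable {A : Set G}

theorem connected_mulCayley (hA : Subgroup.closure A = ⊤) : (mulCayley A).Connected := by
  have key : ∀ g x : G, (mulCayley A).Reachable x (x * g) := by
    intro g
    induction (hA ▸ Subgroup.mem_top g : g ∈ Subgroup.closure A)
      using Subgroup.closure_induction with
    | mem a ha =>
      intro x
      by_cases h : x = x * a
      · rw [← h]
      · exact Adj.reachable ((mulCayley_adj _ _ _).2 ⟨h, .inl (by simpa using ha)⟩)
    | one => intro x; rw [mul_one]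
    | mul a b _ _ iha ihb => intro x; rw [← mul_assoc]; exact (iha x).trans (ihb _)
    | inv a _ ih => intro x; simpa using (ih (x * a⁻¹)).symm
  exact ⟨fun x y => by simpa using key (x⁻¹ * y) x⟩

theorem dist_mulCayley_mul_left (hA : Subgroup.closure A = ⊤) (a x y : G) :
    (mulCayley A).dist (a * x) (a * y) = (mulCayley A).dist x y := by
  have key : ∀ a x y : G, (mulCayley A).dist (a * x) (a * y) ≤ (mulCayley A).dist x y := by
    intro a x y
    obtain ⟨p, hp⟩ := (connected_mulCayley hA).exists_walk_length_eq_dist x y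
    rw [← hp, ← Walk.length_map (mulCayleyMulLeft A a) p]
    exact dist_le _
  refine (key a x y).antisymm ?_
  simpa using key a⁻¹ (a * x) (a * y)

theorem finite_setOf_dist_mulCayley_le (hA : Subgroup.closure A = ⊤) (hf : A.Finite) (n : ℕ) :
    {g | (mulCayley A).dist 1 g ≤ n}.Finite := by
  have key : {g | ∃ p : (mulCayley A).Walk g 1, p.length ≤ n}.Finite := by
    induction n with
    | zero =>
      refine (Set.finite_singleton 1).subset ?_
      rintro g ⟨p, hp⟩
      exact Walk.eq_of_length_eq_zero (Nat.le_zero.1 hp)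
    | succ n ih =>
      refine ((Set.finite_singleton 1).union
        (ih.biUnion fun v _ => (hf.union hf.inv).image (v * ·))).subset ?_
      rintro g ⟨p, hp⟩
      cases p with
      | nil => exact .inl rfl
      | @cons _ v _ h p =>
        refine .inr (Set.mem_biUnion (x := v) ⟨p, by simpa using hp⟩ ⟨v⁻¹ * g, ?_, by simp⟩)
        rcases ((mulCayley_adj _ _ _).1 h).2 with h | h
        · exact .inr (by simpa using h)
        · exact .inl h
  refine key.subset fun g hg => ?_
  obtain ⟨p, hp⟩ := (connected_mulCayley hA).exists_walk_length_eq_dist g 1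
  exact ⟨p, by rw [hp, dist_comm]; exact hg⟩

variable {δ : ℕ}

/-- If `u` and `g` commute, then `u` moves points deep inside a geodesic from `1` to `g` to points
near that geodesic. -/
theorem HasSlimTriangles.exists_dist_mul_le (hδ : (mulCayley A).HasSlimTriangles δ)
    (hA : Subgroup.closure A = ⊤) {u g m : G} (hug : Commute u g) {γ : (mulCayley A).Walk 1 g}
    (hγ : γ.length = (mulCayley A).dist 1 g) (hm : m ∈ γ.support)
    (h₁ : (mulCayley A).dist 1 u + 2 * δ < (mulCayley A).dist 1 m)
    (h₂ : (mulCayley A).dist 1 u + 2 * δ < (mulCayley A).dist m g) :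
    ∃ p ∈ γ.support, (mulCayley A).dist (u * m) p ≤ 2 * δ := by
  have hΓ := connected_mulCayley hA
  have inv := dist_mulCayley_mul_left hA
  let γ' : (mulCayley A).Walk (u * 1) (u * g) := γ.map (mulCayleyMulLeft A u)
  have hγ' : γ'.length = (mulCayley A).dist (u * 1) (u * g) := by
    rw [inv, ← hγ]
    exact Walk.length_map (mulCayleyMulLeft A u) γ
  have hm' : u * m ∈ γ'.support := by
    exact (Walk.support_map (mulCayleyMulLeft A u) γ).symm ▸ List.mem_map_of_mem hm
  obtain ⟨q, hq⟩ := hΓ.exists_walk_length_eq_dist (u * g) g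
  obtain ⟨s, hs⟩ := hΓ.exists_walk_length_eq_dist 1 (u * 1)
  obtain ⟨t, ht | ht | ht, hd⟩ := hδ.exists_dist_le_of_quadrilateral hΓ hγ' hq
    (r := γ.reverse) (by rw [Walk.length_reverse, hγ, dist_comm]) hs hm'
  -- The short sides have length `|u|` (for this one because `u g = g u`), so a close point on
  -- either would put `m` within `|u| + 2δ` of an end of `γ`.
  · have e₁ := Walk.dist_add_dist_of_mem_support hq ht
    have e₂ : (mulCayley A).dist (u * g) g = (mulCayley A).dist 1 u := by
      rw [hug.eq, dist_comm, ← inv g 1 u, mul_one]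
    have e₃ := hΓ.dist_triangle (u := u * m) (v := t) (w := u * g)
    rw [inv, dist_comm (u := t)] at e₃
    omega
  · exact ⟨t, by simpa using ht, hd⟩
  · have e₁ := Walk.dist_add_dist_of_mem_support hs ht
    have e₃ := hΓ.dist_triangle (u := u * m) (v := t) (w := u * 1)
    rw [inv, dist_comm (u := m)] at e₃
    rw [mul_one] at e₁ e₃
    omega

/-- The point of `γ` near `u m` has distance from `1` within `|u| + 2δ` of that of `m`; on a
geodesic this bounds its distance to `m`. -/
theorem HasSlimTriangles.dist_mul_le_of_commute (hδ : (mulCayley A).HasSlimTriangles δ)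
    (hA : Subgroup.closure A = ⊤) {u g m : G} (hug : Commute u g) {γ : (mulCayley A).Walk 1 g}
    (hγ : γ.length = (mulCayley A).dist 1 g) (hm : m ∈ γ.support)
    (h₁ : (mulCayley A).dist 1 u + 2 * δ < (mulCayley A).dist 1 m)
    (h₂ : (mulCayley A).dist 1 u + 2 * δ < (mulCayley A).dist m g) :
    (mulCayley A).dist m (u * m) ≤ (mulCayley A).dist 1 u + 4 * δ := by
  have hΓ := connected_mulCayley hA
  have inv := dist_mulCayley_mul_left hA
  obtain ⟨p, hp, hpd⟩ := hδ.exists_dist_mul_le hA hug hγ hm h₁ h₂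
  have e₁ : (mulCayley A).dist u (u * m) = (mulCayley A).dist 1 m := by
    simpa using inv u 1 m
  have t₁ := hΓ.dist_triangle (u := m) (v := p) (w := u * m)
  have t₂ := hΓ.dist_triangle (u := 1) (v := u) (w := u * m)
  have t₃ := hΓ.dist_triangle (u := 1) (v := u * m) (w := p)
  have t₄ := hΓ.dist_triangle (u := u) (v := p) (w := u * m)
  have t₅ := hΓ.dist_triangle (u := u) (v := 1) (w := p)
  have c₁ := dist_comm (G := mulCayley A) (u := u) (v := 1)
  have c₂ := dist_comm (G := mulCayley A) (u := p) (v := u * m)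
  have c₃ := dist_comm (G := mulCayley A) (u := p) (v := m)
  have f₁ := Walk.dist_add_dist_of_mem_support hγ hp
  have f₂ := Walk.dist_add_dist_of_mem_support hγ hm
  rcases Walk.dist_add_dist_add_dist_of_mem_support hγ hm hp with h | h <;> omega

/-- If `u` commutes with `g` and `g` is not longer than `u * g` and `u⁻¹ * g`, then `u` moves the
points deep inside a geodesic from `1` to `g` only a little. -/
theorem HasSlimTriangles.dist_mul_le_of_minimal (hδ : (mulCayley A).HasSlimTriangles δ)
    (hA : Subgroup.closure A = ⊤) {u g m : G} (hug : Commute u g) {γ : (mulCayley A).Walk 1 g}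
    (hγ : γ.length = (mulCayley A).dist 1 g) (hm : m ∈ γ.support)
    (h₁ : (mulCayley A).dist 1 u + 2 * δ < (mulCayley A).dist 1 m)
    (h₂ : (mulCayley A).dist 1 u + 2 * δ < (mulCayley A).dist m g)
    (hmin : (mulCayley A).dist 1 g ≤ (mulCayley A).dist 1 (u * g))
    (hmin' : (mulCayley A).dist 1 g ≤ (mulCayley A).dist 1 (u⁻¹ * g)) :
    (mulCayley A).dist m (u * m) ≤ 4 * δ := by
  have hΓ := connected_mulCayley hA
  have inv := dist_mulCayley_mul_left hA
  obtain ⟨p, hp, hpd⟩ := hδ.exists_dist_mul_le hA hug hγ hm h₁ h₂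
  have e₁ : (mulCayley A).dist u (u * m) = (mulCayley A).dist 1 m := by
    simpa using inv u 1 m
  have e₂ := inv u m g
  have e₃ : (mulCayley A).dist 1 (u⁻¹ * g) = (mulCayley A).dist u g := by
    simpa using (inv u 1 (u⁻¹ * g)).symm
  have t₁ := hΓ.dist_triangle (u := m) (v := p) (w := u * m)
  have c₂ := dist_comm (G := mulCayley A) (u := p) (v := u * m)
  have c₃ := dist_comm (G := mulCayley A) (u := p) (v := m)
  have f₂ := Walk.dist_add_dist_of_mem_support hγ hm
  -- If `p` were more than `2δ` past `m`, the route `u`, `u m`, `p`, `g` would make `u⁻¹ g` shorter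
  -- than `g`; if more than `2δ` before it, the route `1`, `p`, `u m`, `u g` would make `u g`
  -- shorter.
  rcases Walk.dist_add_dist_add_dist_of_mem_support hγ hm hp with h | h
  · have t₂ := hΓ.dist_triangle (u := u) (v := u * m) (w := g)
    have t₃ := hΓ.dist_triangle (u := u * m) (v := p) (w := g)
    omega
  · have t₂ := hΓ.dist_triangle (u := 1) (v := u * m) (w := u * g)
    have t₃ := hΓ.dist_triangle (u := 1) (v := p) (w := u * m)
    omega

/-- Balls are finite and the powers of an element of infinite order are distinct, so only finitely
many exponents fail for some `b`. -/
theorem exists_pow_forall_lt_dist_mulCayley (hA : Subgroup.closure A = ⊤) (hf : A.Finite)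
    (K n : ℕ) : ∃ N : ℕ, ∀ b : G, (mulCayley A).dist 1 b ≤ K → ¬IsOfFinOrder b →
      n < (mulCayley A).dist 1 (b ^ N) := by
  have hfin : (⋃ b ∈ {b : G | (mulCayley A).dist 1 b ≤ K ∧ ¬IsOfFinOrder b},
      {N : ℕ | (mulCayley A).dist 1 (b ^ N) ≤ n}).Finite := by
    refine ((finite_setOf_dist_mulCayley_le hA hf K).subset fun b hb => hb.1).biUnion
      fun b hb => ?_
    exact (finite_setOf_dist_mulCayley_le hA hf n).preimage
      (injective_pow_iff_not_isOfFinOrder.2 hb.2).injOn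
  obtain ⟨N, hN⟩ := hfin.exists_notMem
  refine ⟨N, fun b hb hb' => ?_⟩
  by_contra! hle
  exact hN (Set.mem_biUnion (x := b) ⟨hb, hb'⟩ hle)

end Cayley

end SimpleGraph

open SimpleGraph in
/-- In a hyperbolic group, an element of infinite order generates a subgroup of finite index in its
centralizer. -/
theorem IsHyperbolicGroup.exists_finite_commute {G : Type*} [Group G] (hG : IsHyperbolicGroup G)
    {h : G} (hh : ¬IsOfFinOrder h) :
    ∃ F : Set G, F.Finite ∧ ∀ c, Commute c h → ∃ u ∈ Subgroup.zpowers h, ∃ f ∈ F, c = u * f := by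
  obtain ⟨A, hf, -, hA, δ, hδ⟩ := hG
  have inv := dist_mulCayley_mul_left hA
  obtain ⟨N, hN⟩ := exists_pow_forall_lt_dist_mulCayley hA hf
    ((mulCayley A).dist 1 h + 4 * δ) (4 * δ)
  set w := h ^ N with hw
  -- Large enough that a point at distance at least `r` from both ends is deep for `h` and for `w`
  -- alike.
  let r := (mulCayley A).dist 1 h + (mulCayley A).dist 1 w + 2 * δ + 1
  refine ⟨_, finite_setOf_dist_mulCayley_le hA hf (2 * r), fun c hc => ?_⟩
  let ℓ : ℤ → ℕ := fun n => (mulCayley A).dist 1 (w ^ n * c)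
  obtain ⟨n, hn⟩ : ∃ n, ∀ k, ℓ n ≤ ℓ k := ⟨_, fun k => Function.argmin_le ℓ k⟩
  have hmin : ∀ k : ℤ, (mulCayley A).dist 1 (w ^ n * c) ≤ (mulCayley A).dist 1 (w ^ k * c) :=
    hn
  set g := w ^ n * c with hg
  have hmul : w * g = w ^ (1 + n) * c := by rw [hg, ← mul_assoc, zpow_one_add]
  have hmul' : w⁻¹ * g = w ^ (-1 + n) * c := by rw [hg, ← mul_assoc, zpow_add, zpow_neg_one]
  have hgh : Commute h g := (((Commute.refl h).pow_right N).zpow_right n).mul_right hc.symm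
  refine ⟨(w ^ n)⁻¹, inv_mem (zpow_mem (pow_mem (Subgroup.mem_zpowers h) N) n), g, ?_,
    by rw [hg, inv_mul_cancel_left]⟩
  rw [Set.mem_ofPred_eq]
  by_contra! hlt
  obtain ⟨γ, hγ⟩ := (connected_mulCayley hA).exists_walk_length_eq_dist 1 g
  obtain ⟨m, hm, hmr⟩ := Walk.exists_mem_support_dist_eq hγ (n := r) (by omega)
  have hmg := Walk.dist_add_dist_of_mem_support hγ hm
  have hconj : ∀ u : G, (mulCayley A).dist m (u * m) = (mulCayley A).dist 1 (m⁻¹ * u * m) := by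
    intro u
    rw [← inv m 1]
    simp [mul_assoc]
  -- With `b = m⁻¹ h m`, this gives `|b| ≤ |h| + 4δ`, and the next bound gives `|b ^ N| ≤ 4δ`,
  -- contrary to the choice of `N`.
  have h₁ := hδ.dist_mul_le_of_commute hA hgh hγ hm (by omega) (by omega)
  have h₂ := hδ.dist_mul_le_of_minimal hA (u := w) (hgh.pow_left N) hγ hm (by omega) (by omega)
    (hmul ▸ hmin _) (hmul' ▸ hmin _)
  have hpow : m⁻¹ * h ^ N * m = (m⁻¹ * h * m) ^ N := by
    simpa using (conj_pow (a := m⁻¹) (b := h) (i := N)).symm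
  rw [hconj] at h₁ h₂
  rw [hpow] at h₂
  refine (hN _ h₁ fun hfin => hh ?_).not_ge h₂
  have := (MulAut.conj m).toMonoidHom.isOfFinOrder hfin
  simpa [mul_assoc] using this

theorem proposition4p1 {G : Type*} [Group G] (hG : IsHyperbolicGroup G)
    (hcs : IsHereditarilyConjugacySeparable G) (H : Subgroup G) (htf : IsTorsionFreeGroup H)
    (hsep : IsSeparableIn (H : Set G)) : IsConjugacySeparable H := by
  refine hcs.isConjugacySeparable_of_finite H hsep fun h hh hne => ?_
  obtain ⟨F, hF, hcov⟩ := hG.exists_finite_commute (h := h) fun hfin => hne <|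
    congrArg Subtype.val (htf ⟨h, hh⟩ (Submonoid.isOfFinOrder_coe.1 hfin))
  refine ⟨F, hF, fun c hc => ?_⟩
  obtain ⟨u, hu, f, hf, huf⟩ := hcov c hc
  exact ⟨u, (Subgroup.zpowers_le.2 hh) hu, f, hf, huf⟩
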